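/- Let $(X,\mathsf d)$ be a complete separable metric space, let $\mathcal M(X)$, $\mathcal M(X\times X)$ be the sets of finite nonnegative Borel measures on $X$ and $X\times X$ (such measures are automatically Radon), and let $c:X\times X\to(-\infty,+\infty]$ be lower semicontinuous and bounded from below. Let $F(s)=s\log s-s+1$ for $s\ge 0$ (with $0\log 0=0$, so $F(0)=1$) be the Kullback–Leibler entropy function, with recession constant $F'_\infty=\lim_{s\to\infty}F(s)/s=+\infty$. For finite measures $\gamma,\mu$ on the same space with Lebesgue decomposition $\gamma=\sigma\mu+\gamma^\perp$, put $$\mathcal F(\gamma\mid\mu)=\int F(\sigma)\,d\mu+F'_\infty\,\gamma^\perp(\text{whole space})\in[0,+\infty],\qquad \infty\cdot 0=0 .$$ Let $F^*(\phi)=\sup_{s\ge 0}\,(s\phi-F(s))$ be the Legendre dual of $F$, with the convention $F^*(-\infty)=-F(0)$ (explicitly, $F^*(\phi)=e^{\phi}-1$ and $F^*(-\infty)=-1$). Let $\mu_0,\mu_1\in\mathcal M(X)$, $\nu_X\in\mathcal M(X\times X)$ and $\varepsilon>0$, write $\gamma_0,\gamma_1$ for the marginals of $\gamma\in\mathcal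 M(X\times X)$, and define $$\mathrm{UOT}_{X,\varepsilon}(\mu_0,\mu_1)=\inf_{\gamma\in\mathcal M(X\times X)}\Big\{\mathcal F(\gamma_0\mid\mu_0)+\mathcal F(\gamma_1\mid\mu_1)+\int_{X\times X}c\,d\gamma+\varepsilon\,\mathcal F(\gamma\mid\nu_X)\Big\}.$$ Then $$\mathrm{UOT}_{X,\varepsilon}(\mu_0,\mu_1)=\sup_{(\phi_0,\phi_1)\in\tilde\Phi}\Big\{\sum_{i=0,1}\int_X-F^*(-\phi_i)\,d\mu_i+\varepsilon\int_{X\times X}-F^*\Big(\frac{\phi_0(x_0)+\phi_1(x_1)-c(x_0,x_1)}{\varepsilon}\Big)d\nu_X(x_0,x_1)\Big\},$$ where $\tilde\Phi=\{(\phi_0,\phi_1)\in C_b(X)\times C_b(X) : -F^*(-\phi_i)\in C_b(X),\ i=0,1\}$. -/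

import Mathlib

open MeasureTheory Filter Topology
open scoped NNReal ENNReal BoundedContinuousFunction

noncomputable section

namespace UOT

/-- The integral `∫ g dμ = ∫ g⁺ dμ - ∫ g⁻ dμ` of an extended-real-valued function. It is only used
where `∫ g⁻ dμ` is finite. -/
def eintegral {α : Type*} [MeasurableSpace α] (μ : Measure α) (g : α → EReal) : EReal :=
  ((∫⁻ x, (g x).toENNReal ∂μ : ℝ≥0∞) : EReal) - ((∫⁻ x, (-g x).toENNReal ∂μ : ℝ≥0∞) : EReal)

/-- The recession constant `F'_∞ = lim_{s → ∞} F(s) / s` of an entropy function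
(the limit exists for convex `F`). -/
def recession (F : ℝ≥0 → ℝ≥0∞) : ℝ≥0∞ :=
  limsup (fun s : ℝ≥0 => F s / (s : ℝ≥0∞)) atTop

/-- The relative entropy functional `𝓕(γ ∣ μ) = ∫ F(σ) dμ + F'_∞ γ^⊥(univ)`, where
`γ = σ μ + γ^⊥` is the Lebesgue decomposition of `γ` with respect to `μ`. -/
def entropyFunctional {α : Type*} [MeasurableSpace α] (F : ℝ≥0 → ℝ≥0∞) (γ μ : Measure α) :
    ℝ≥0∞ :=
  (∫⁻ x, F (γ.rnDeriv μ x).toNNReal ∂μ) + recession F * γ.singularPart μ Set.univ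

/-- The Legendre dual `F^*(φ) = sup_{s ≥ 0} (s φ - F(s))` of a scalar function on `[0, ∞)`.
It is evaluated at extended reals, with the convention `0 * (-∞) = 0`, so that
`F^*(-∞) = -F(0)`. -/
def legendre (F : ℝ≥0 → ℝ≥0∞) (φ : EReal) : EReal :=
  ⨆ s : ℝ≥0, (((s : ℝ) : EReal) * φ - ((F s : ℝ≥0∞) : EReal))

/-- The Kullback-Leibler entropy function `F(s) = s log s - s + 1` (with `F(0) = 1`). -/
def klEntropy (s : ℝ≥0) : ℝ≥0∞ :=
  ENNReal.ofReal ((s : ℝ) * Real.log (s : ℝ) - (s : ℝ) + 1)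

variable {X : Type*} [MeasurableSpace X]

/-- The primal functional
`𝓔(γ ∣ μ₀, μ₁) = 𝓕(γ₀ ∣ μ₀) + 𝓕(γ₁ ∣ μ₁) + ∫ c dγ`, with `γ₀, γ₁` the marginals of `γ`. -/
def primal (c : X × X → EReal) (μ₀ μ₁ : FiniteMeasure X) (γ : FiniteMeasure (X × X)) : EReal :=
  ((entropyFunctional klEntropy ((γ : Measure (X × X)).map Prod.fst) (μ₀ : Measure X) : ℝ≥0∞)
      : EReal)
    + ((entropyFunctional klEntropy ((γ : Measure (X × X)).map Prod.snd) (μ₁ : Measure X) : ℝ≥0∞)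
      : EReal)
    + eintegral (γ : Measure (X × X)) c

/-- The regularised primal functional
`𝓔_ε(γ ∣ μ₀, μ₁, ν) = 𝓔(γ ∣ μ₀, μ₁) + ε 𝓕(γ ∣ ν)`. -/
def primalReg (c : X × X → EReal) (ε : ℝ) (μ₀ μ₁ : FiniteMeasure X)
    (ν γ : FiniteMeasure (X × X)) : EReal :=
  primal c μ₀ μ₁ γ
    + (ε : EReal) * ((entropyFunctional klEntropy (γ : Measure (X × X)) (ν : Measure (X × X))
      : ℝ≥0∞) : EReal)

/-- `UOT_{X,ε}(μ₀, μ₁)`: the infimum of `𝓔_ε` over all finite measures on `X × X`. -/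
def uotReg (c : X × X → EReal) (ε : ℝ) (μ₀ μ₁ : FiniteMeasure X)
    (ν : FiniteMeasure (X × X)) : EReal :=
  ⨅ γ : FiniteMeasure (X × X), primalReg c ε μ₀ μ₁ ν γ

/-- The dual functional
`∑ᵢ μᵢ(-F^*(-φᵢ)) + ε ν(-F^*((φ₀ ⊕ φ₁ - c) / ε))`. -/
def dualReg (c : X × X → EReal) (ε : ℝ) (μ₀ μ₁ : FiniteMeasure X) (ν : FiniteMeasure (X × X))
    (φ₀ φ₁ : X → ℝ) : EReal :=
  eintegral (μ₀ : Measure X) (fun x => -legendre klEntropy ((-φ₀ x : ℝ) : EReal))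
    + eintegral (μ₁ : Measure X) (fun x => -legendre klEntropy ((-φ₁ x : ℝ) : EReal))
    + (ε : EReal) * eintegral (ν : Measure (X × X))
        (fun z => -legendre klEntropy ((((φ₀ z.1 + φ₁ z.2 : ℝ) : EReal) - c z) / (ε : EReal)))

/-- The admissible potentials: pairs of bounded continuous functions `φ₀, φ₁` such that
`-F^*(-φ₀)` and `-F^*(-φ₁)` are again real-valued, bounded and continuous. -/
def admissible (X : Type*) [TopologicalSpace X] : Set ((X →ᵇ ℝ) × (X →ᵇ ℝ)) :=
  {φ | (∃ ψ : X →ᵇ ℝ, ∀ x, -legendre klEntropy ((-φ.1 x : ℝ) : EReal) = ((ψ x : ℝ) : EReal)) ∧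
       (∃ ψ : X →ᵇ ℝ, ∀ x, -legendre klEntropy ((-φ.2 x : ℝ) : EReal) = ((ψ x : ℝ) : EReal))}

end UOT

end

noncomputable section

namespace UOT

open InformationTheory

/-! ### Minimizing `∫ exp` over a linear space of bounded functions -/

section ExpMinimization

variable {Ω : Type*} [MeasurableSpace Ω] {M : Measure Ω} [IsFiniteMeasure M]

/-! Since `F^*(φ) = exp φ - 1`, the dual functional is, up to a constant, `∫ (1 - exp v) dM`. Here
`M` is the finite measure on `X ⊕ (X ⊕ X × X)` with parts `μ₀`, `μ₁` and `ε e^{-c/ε} ν`, and `v`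
runs over the linear space `V` of functions `(-φ₀, -φ₁, (φ₀ ⊕ φ₁)/ε)`. The dual problem is thus the
minimization of `∫ exp v dM` over `V`.

No compactness or minimax theorem is needed. The convexity gap of `exp` is an exact square, `e^u +
e^v - 2 e^{(u+v)/2} = (e^{u/2} - e^{v/2})²`, so the densities `exp (u n)` of a suitable minimizing
sequence are Cauchy in `L¹(M)`, whether or not the potentials converge. Their limit `w` annihilates
`V` by first order optimality; read on the three parts, this says that the measure `γ = e^{-c/ε} w
ν` on `X × X` has marginals `w μ₀` and `w μ₁`. Since `klFun (e^u) = u e^u + (1 - e^u)`, and `∫ u e^u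
≤ 0` once `u` is optimal on its ray, Fatou bounds the entropy of `w` by any upper bound of the dual
values (`exists_density_integral_klFun_le`). That entropy is the primal value of `γ` up to the same
constant (`primalReg_withDensity`), so `γ` attains the bound.

The reverse inequality integrates Young's inequality `s x ≤ F(s) + e^x - 1`
(`dualValue_le_primalReg`). -/

lemma integrable_of_bdd {f : Ω → ℝ} (hf : Measurable f) {C : ℝ} (hC : ∀ x, |f x| ≤ C) :
    Integrable f M :=
  Integrable.of_bound hf.aestronglyMeasurable C (ae_of_all _ hC)

lemma integrable_exp_of_bdd {f : Ω → ℝ} (hf : Measurable f) {C : ℝ} (hC : ∀ x, |f x| ≤ C) :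
    Integrable (fun x => Real.exp (f x)) M := by
  refine integrable_of_bdd hf.exp (C := Real.exp C) fun x => ?_
  rw [Real.abs_exp]
  exact Real.exp_le_exp.2 ((le_abs_self _).trans (hC x))

lemma integrable_mul_exp_of_bdd {u v : Ω → ℝ} (hu : Measurable u) {C : ℝ} (hC : ∀ x, |u x| ≤ C)
    (hv : Measurable v) {K : ℝ} (hK : ∀ x, |v x| ≤ K) :
    Integrable (fun x => v x * Real.exp (u x)) M :=
  (integrable_exp_of_bdd hu hC).bdd_mul (c := K) hv.aestronglyMeasurable (ae_of_all _ hK)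

/-- Second order upper bound for `u ↦ ∫ exp u` along a bounded direction. -/
lemma integral_exp_add_smul_le {u v : Ω → ℝ} (hu : Measurable u) {C : ℝ} (hC : ∀ x, |u x| ≤ C)
    (hv : Measurable v) {K : ℝ} (hK : ∀ x, |v x| ≤ K) {s : ℝ} (hs : 0 ≤ s) (hsK : s * K ≤ 1) :
    ∫ x, Real.exp (u x + s * v x) ∂M ≤
      ∫ x, Real.exp (u x) ∂M + s * ∫ x, v x * Real.exp (u x) ∂M
        + s ^ 2 * K ^ 2 * ∫ x, Real.exp (u x) ∂M := by
  have h1 := integrable_exp_of_bdd (M := M) hu hC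
  have h2 := integrable_mul_exp_of_bdd (M := M) hu hC hv hK
  have h3 : Integrable (fun x => Real.exp (u x + s * v x)) M := by
    refine integrable_exp_of_bdd (C := C + s * K) (by fun_prop) fun x => ?_
    refine (abs_add_le _ _).trans (add_le_add (hC x) ?_)
    rw [abs_mul, abs_of_nonneg hs]
    exact mul_le_mul_of_nonneg_left (hK x) hs
  have h12 : Integrable (fun x => Real.exp (u x) + s * (v x * Real.exp (u x))) M :=
    h1.add (h2.const_mul s)
  rw [← integral_const_mul, ← integral_const_mul, ← integral_add h1 (h2.const_mul s),
    ← integral_add h12 (h1.const_mul _)]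
  refine integral_mono h3 (h12.add (h1.const_mul _)) fun x => ?_
  have hK0 : 0 ≤ K := (abs_nonneg _).trans (hK x)
  have hb : |s * v x| ≤ s * K := by
    rw [abs_mul, abs_of_nonneg hs]
    exact mul_le_mul_of_nonneg_left (hK x) hs
  -- `e^y ≤ 1 + y + y²` for `|y| ≤ 1`, with `y = s v`; this is where `s * K ≤ 1` is used.
  have h4 := (abs_le.1 (Real.abs_exp_sub_one_sub_id_le (hb.trans hsK))).2
  have h5 : (s * v x) ^ 2 ≤ (s * K) ^ 2 := sq_le_sq' (by linarith [(abs_le.1 hb).1]) (abs_le.1 hb).2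
  have h6 : Real.exp (s * v x) ≤ 1 + s * v x + s ^ 2 * K ^ 2 := by nlinarith
  have := mul_le_mul_of_nonneg_left h6 (Real.exp_pos (u x)).le
  beta_reduce
  rw [Real.exp_add]
  linarith

/-- A minimizer of `t ↦ ∫ exp (t v)` over `[0, 1]`, and the resulting first order condition. -/
lemma exists_ray_minimizer {v : Ω → ℝ} (hv : Measurable v) {C : ℝ} (hC : ∀ x, |v x| ≤ C) :
    ∃ t ∈ Set.Icc (0 : ℝ) 1, ∫ x, Real.exp (t * v x) ∂M ≤ ∫ x, Real.exp (v x) ∂M ∧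
      ∫ x, (t * v x) * Real.exp (t * v x) ∂M ≤ 0 := by
  have hC' : ∀ t ∈ Set.Icc (0 : ℝ) 1, ∀ x, |t * v x| ≤ C := fun t ht x => by
    rw [abs_mul, abs_of_nonneg ht.1]
    exact (mul_le_of_le_one_left (abs_nonneg _) ht.2).trans (hC x)
  have hcont : ContinuousOn (fun t : ℝ => ∫ x, Real.exp (t * v x) ∂M) (Set.Icc 0 1) := by
    refine continuousOn_of_dominated (bound := fun _ => Real.exp C)
      (fun t _ => (by fun_prop : Measurable fun x => Real.exp (t * v x)).aestronglyMeasurable)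
      (fun t ht => ae_of_all _ fun x => ?_) (integrable_const _)
      (ae_of_all _ fun x => by fun_prop)
    rw [Real.norm_eq_abs, Real.abs_exp]
    exact Real.exp_le_exp.2 ((le_abs_self _).trans (hC' t ht x))
  obtain ⟨t, ht, hmin⟩ := isCompact_Icc.exists_isMinOn (Set.nonempty_Icc.2 zero_le_one) hcont
  refine ⟨t, ht, ?_, ?_⟩
  · simpa using hmin (Set.right_mem_Icc.2 zero_le_one)
  · set E := ∫ x, Real.exp (t * v x) ∂M
    set B := ∫ x, (t * v x) * Real.exp (t * v x) ∂M
    -- Compare with `(1 - s) t`: shrinking stays inside `[0, 1]` even when `t = 1`, so the one-sided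
    -- derivative gives the sign of `B`.
    have key : ∀ s : ℝ, 0 < s → s ≤ 1 → s * C ≤ 1 → B ≤ s * (C ^ 2 * E) := by
      intro s hs hs1 hsC
      have h1 := integral_exp_add_smul_le (M := M) (u := fun x => t * v x)
        (v := fun x => -(t * v x)) (by fun_prop) (hC' t ht) (by fun_prop)
        (K := C) (fun x => by rw [abs_neg]; exact hC' t ht x) hs.le hsC
      have h2 : E ≤ ∫ x, Real.exp (((1 - s) * t) * v x) ∂M :=
        hmin ⟨mul_nonneg (by linarith) ht.1,
          (mul_le_of_le_one_left ht.1 (by linarith)).trans ht.2⟩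
      have h3 : (fun x => Real.exp (t * v x + s * -(t * v x)))
          = fun x => Real.exp (((1 - s) * t) * v x) := by
        ext x; ring_nf
      have h4 : ∫ x, -(t * v x) * Real.exp (t * v x) ∂M = -B := by
        simp only [neg_mul, integral_neg, B]
      rw [h3, h4] at h1
      have : s * B ≤ s * (s * (C ^ 2 * E)) := by nlinarith
      exact le_of_mul_le_mul_left this hs
    have hlim : Tendsto (fun s : ℝ => s * (C ^ 2 * E)) (𝓝[>] 0) (𝓝 0) := by
      have : Tendsto (fun s : ℝ => s * (C ^ 2 * E)) (𝓝 0) (𝓝 (0 * (C ^ 2 * E))) :=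
        (continuous_id.mul continuous_const).tendsto 0
      rw [zero_mul] at this
      exact this.mono_left nhdsWithin_le_nhds
    have hsC : ∀ᶠ s : ℝ in 𝓝[>] 0, s * C ≤ 1 := by
      have : Tendsto (fun s : ℝ => s * C) (𝓝 0) (𝓝 (0 * C)) :=
        (continuous_id.mul continuous_const).tendsto 0
      rw [zero_mul] at this
      exact (this.mono_left nhdsWithin_le_nhds).eventually (eventually_le_nhds one_pos)
    refine ge_of_tendsto hlim ?_
    filter_upwards [hsC, Ioc_mem_nhdsGT one_pos] with s h1 h2 using key s h2.1 h2.2 h1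

/-- Quantitative strict convexity of `u ↦ ∫ exp u`. -/
lemma integral_abs_exp_sub_exp_le {u v : Ω → ℝ} (hu : Measurable u) {C : ℝ} (hC : ∀ x, |u x| ≤ C)
    (hv : Measurable v) {K : ℝ} (hK : ∀ x, |v x| ≤ K) {l : ℝ} (hl : 0 < l) :
    ∫ x, |Real.exp (u x) - Real.exp (v x)| ∂M ≤
      l / 2 * (∫ x, Real.exp (u x) ∂M + ∫ x, Real.exp (v x) ∂M
        - 2 * ∫ x, Real.exp ((1 / 2) * (u x + v x)) ∂M)
      + 1 / l * (∫ x, Real.exp (u x) ∂M + ∫ x, Real.exp (v x) ∂M) := by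
  have h1 := integrable_exp_of_bdd (M := M) hu hC
  have h2 := integrable_exp_of_bdd (M := M) hv hK
  have h3 : Integrable (fun x => Real.exp ((1 / 2) * (u x + v x))) M := by
    refine integrable_exp_of_bdd (C := C + K) (by fun_prop) fun x => ?_
    have := (abs_add_le _ _).trans (add_le_add (hC x) (hK x))
    rw [abs_mul, abs_of_pos (by norm_num : (0 : ℝ) < 1 / 2)]
    linarith [abs_nonneg (u x + v x)]
  have h12 : Integrable (fun x => Real.exp (u x) + Real.exp (v x)) M := h1.add h2
  have h123 : Integrable (fun x => Real.exp (u x) + Real.exp (v x)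
      - 2 * Real.exp ((1 / 2) * (u x + v x))) M := h12.sub (h3.const_mul 2)
  rw [← integral_add h1 h2, ← integral_const_mul, ← integral_sub h12 (h3.const_mul 2),
    ← integral_const_mul, ← integral_const_mul,
    ← integral_add (h123.const_mul _) (h12.const_mul _)]
  refine integral_mono (h1.sub h2).abs ((h123.const_mul _).add (h12.const_mul _)) fun x => ?_
  beta_reduce
  -- In terms of the square roots `a`, `b`, the gap is `(a - b)²` and the difference is `(a - b)(a +
  -- b)`; conclude by the weighted AM-GM inequality with weight `l`.
  obtain ⟨a, ha⟩ : ∃ a, a = Real.exp ((1 / 2) * u x) := ⟨_, rfl⟩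
  obtain ⟨b, hb⟩ : ∃ b, b = Real.exp ((1 / 2) * v x) := ⟨_, rfl⟩
  have ea : Real.exp (u x) = a ^ 2 := by rw [ha, ← Real.exp_nat_mul]; congr 1; push_cast; ring
  have eb : Real.exp (v x) = b ^ 2 := by rw [hb, ← Real.exp_nat_mul]; congr 1; push_cast; ring
  have eab : Real.exp ((1 / 2) * (u x + v x)) = a * b := by rw [mul_add, Real.exp_add, ha, hb]
  have ha0 : 0 < a := ha ▸ Real.exp_pos _
  have hb0 : 0 < b := hb ▸ Real.exp_pos _
  rw [ea, eb, eab, show a ^ 2 - b ^ 2 = (a - b) * (a + b) by ring, abs_mul, abs_of_pos (by positivity : 0 < a + b)]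
  have h4 : |a - b| * (a + b) ≤ l / 2 * |a - b| ^ 2 + 1 / (2 * l) * (a + b) ^ 2 := by
    have : 0 ≤ 1 / (2 * l) * (l * |a - b| - (a + b)) ^ 2 := by positivity
    have e : 1 / (2 * l) * (l * |a - b| - (a + b)) ^ 2
      = l / 2 * |a - b| ^ 2 + 1 / (2 * l) * (a + b) ^ 2 - |a - b| * (a + b) := by
      field_simp
      ring
    linarith
  have h5 : 1 / (2 * l) * (a + b) ^ 2 ≤ 1 / l * (a ^ 2 + b ^ 2) := by
    have e : 1 / l * (a ^ 2 + b ^ 2) - 1 / (2 * l) * (a + b) ^ 2 = 1 / (2 * l) * (a - b) ^ 2 := by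
      field_simp
      ring
    have : 0 ≤ 1 / (2 * l) * (a - b) ^ 2 := by positivity
    linarith
  rw [sq_abs] at h4
  have e6 : l / 2 * (a - b) ^ 2 = l / 2 * (a ^ 2 + b ^ 2 - 2 * (a * b)) := by ring
  linarith

/-- Take near-minimizers and replace each by the best point `t • v`, `t ∈ [0, 1]`, of its segment to
`0`: this keeps the integral small and adds the sign `∫ u e^u ≤ 0` needed for the entropy bound. The
rate `16⁻ⁿ` makes the densities summably Cauchy. -/
lemma exists_exp_minimizing_seq (V : Submodule ℝ (Ω → ℝ)) (hVm : ∀ v ∈ V, Measurable v)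
    (hVb : ∀ v ∈ V, ∃ C : ℝ, ∀ x, |v x| ≤ C) :
    ∃ I : ℝ, 0 ≤ I ∧ (∀ v ∈ V, I ≤ ∫ x, Real.exp (v x) ∂M) ∧ ∃ u : ℕ → Ω → ℝ, ∀ n, u n ∈ V ∧
      ∫ x, Real.exp (u n x) ∂M ≤ I + (1 / 16) ^ n ∧ ∫ x, u n x * Real.exp (u n x) ∂M ≤ 0 := by
  set S : Set ℝ := (fun v : Ω → ℝ => ∫ x, Real.exp (v x) ∂M) '' V
  have hS0 : ∀ y ∈ S, 0 ≤ y := by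
    rintro _ ⟨v, -, rfl⟩
    exact integral_nonneg fun x => (Real.exp_pos _).le
  have hSne : S.Nonempty := ⟨_, 0, V.zero_mem, rfl⟩
  refine ⟨sInf S, le_csInf hSne hS0, fun v hv => csInf_le ⟨0, hS0⟩ ⟨v, hv, rfl⟩, ?_⟩
  have h : ∀ n : ℕ, ∃ u : Ω → ℝ, u ∈ V ∧
      ∫ x, Real.exp (u x) ∂M ≤ sInf S + (1 / 16) ^ n ∧ ∫ x, u x * Real.exp (u x) ∂M ≤ 0 := by
    intro n
    obtain ⟨_, ⟨v, hv, rfl⟩, hlt⟩ := exists_lt_of_csInf_lt hSne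
      (lt_add_of_pos_right (sInf S) (by positivity : (0 : ℝ) < (1 / 16) ^ n))
    obtain ⟨C, hC⟩ := hVb v hv
    obtain ⟨t, -, h1, h2⟩ := exists_ray_minimizer (M := M) (hVm v hv) hC
    exact ⟨t • v, V.smul_mem t hv, h1.trans hlt.le, h2⟩
  choose u hu using h
  exact ⟨u, hu⟩

/-- If `∫ exp` is bounded below on a space `V` of bounded functions, then there is a density `w`
annihilating `V` (the limit of the densities `exp u` along a minimizing sequence `u` in `V`) whose
entropy satisfies the dual bound. -/
lemma exists_density_integral_klFun_le (V : Submodule ℝ (Ω → ℝ)) (hVm : ∀ v ∈ V, Measurable v)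
    (hVb : ∀ v ∈ V, ∃ C : ℝ, ∀ x, |v x| ≤ C) {A : ℝ}
    (hA : ∀ v ∈ V, ∫ x, (1 - Real.exp (v x)) ∂M ≤ A) :
    ∃ w : Ω → ℝ, Measurable w ∧ (∀ x, 0 ≤ w x) ∧ Integrable w M ∧
      (∀ v ∈ V, ∫ x, v x * w x ∂M = 0) ∧
      Integrable (fun x => klFun (w x)) M ∧ ∫ x, klFun (w x) ∂M ≤ A := by
  have hA0 : 0 ≤ A := by simpa using hA 0 V.zero_mem
  obtain ⟨I, hI0, hI, u, hu⟩ := exists_exp_minimizing_seq (M := M) V hVm hVb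
  choose C hC using fun n => hVb (u n) (hu n).1
  have hum := fun n => hVm _ (hu n).1
  have hint := fun n => integrable_exp_of_bdd (M := M) (hum n) (hC n)
  set f : ℕ → Ω → ℝ := fun n x => Real.exp (u n x) with hf
  have hfm : ∀ n, AEStronglyMeasurable (f n) M := fun n => (hum n).exp.aestronglyMeasurable
  -- With `l = 4 ^ N` and suboptimality `16⁻ᴺ`, the gap term is at most `4⁻ᴺ` and the other at most
  -- `(2I + 2) 4⁻ᴺ`; `2I + 4` makes the bound strict.
  set B : ℕ → ℝ≥0∞ := fun N => ENNReal.ofReal ((2 * I + 4) * (1 / 4) ^ N) with hB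
  have hBs : ∑' N, B N ≠ ∞ := by
    refine Summable.tsum_ofReal_ne_top ?_
    exact (summable_geometric_of_lt_one (by norm_num) (by norm_num)).mul_left _
  have hcau : ∀ N n m : ℕ, N ≤ n → N ≤ m → eLpNorm (f n - f m) 1 M < B N := by
    intro N n m hn hm
    rw [eLpNorm_one_eq_lintegral_enorm, ← ofReal_integral_norm_eq_lintegral_enorm
      ((hint n).sub (hint m)), hB]
    refine ENNReal.ofReal_lt_ofReal_iff_of_nonneg
      (integral_nonneg fun _ => norm_nonneg _) |>.2 ?_
    have h1 := integral_abs_exp_sub_exp_le (M := M) (hum n) (hC n) (hum m) (hC m)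
      (l := 4 ^ N) (by positivity)
    have h2 := hI _ (V.smul_mem (1 / 2 : ℝ) (V.add_mem (hu n).1 (hu m).1))
    simp only [Pi.smul_apply, Pi.add_apply, smul_eq_mul] at h2
    have hpow : ∀ k, N ≤ k → ((1 : ℝ) / 16) ^ k ≤ (1 / 16) ^ N := fun k hk =>
      pow_le_pow_of_le_one (by norm_num) (by norm_num) hk
    have hn' := (hu n).2.1.trans (add_le_add_right (hpow n hn) I)
    have hm' := (hu m).2.1.trans (add_le_add_right (hpow m hm) I)
    have e1 : (4 : ℝ) ^ N * (1 / 16) ^ N = (1 / 4) ^ N := by rw [← mul_pow]; norm_num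
    have e2 : 1 / (4 : ℝ) ^ N = (1 / 4) ^ N := by rw [one_div_pow]
    have hq1 : ((1 : ℝ) / 16) ^ N ≤ 1 := pow_le_one₀ (by norm_num) (by norm_num)
    have hq4 : (0 : ℝ) < (1 / 4) ^ N := by positivity
    rw [e2] at h1
    simp only [Real.norm_eq_abs, Pi.sub_apply]
    refine h1.trans_lt ?_
    have h3 : (4 : ℝ) ^ N / 2 * (∫ x, Real.exp (u n x) ∂M + ∫ x, Real.exp (u m x) ∂M
        - 2 * ∫ x, Real.exp ((1 / 2) * (u n x + u m x)) ∂M) ≤ 4 ^ N / 2 * (2 * (1 / 16) ^ N) :=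
      mul_le_mul_of_nonneg_left (by linarith) (by positivity)
    have h4 : (1 / 4 : ℝ) ^ N * (∫ x, Real.exp (u n x) ∂M + ∫ x, Real.exp (u m x) ∂M)
        ≤ (1 / 4) ^ N * (2 * I + 2) :=
      mul_le_mul_of_nonneg_left (by linarith) hq4.le
    nlinarith
  obtain ⟨g, hgm, hg⟩ := exists_stronglyMeasurable_limit_of_tendsto_ae hfm
    (Lp.ae_tendsto_of_cauchy_eLpNorm hfm le_rfl hBs hcau)
  -- The limit is nonnegative only almost everywhere; truncation makes it so everywhere.
  set w : Ω → ℝ := fun x => max (g x) 0 with hw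
  have hwm : Measurable w := hgm.measurable.max measurable_const
  have hw0 : ∀ x, 0 ≤ w x := fun x => le_max_right _ _
  have hfw : ∀ᵐ x ∂M, Tendsto (fun n => f n x) atTop (𝓝 (w x)) := by
    filter_upwards [hg] with x hx
    have : 0 ≤ g x := ge_of_tendsto' hx fun n => (Real.exp_pos _).le
    simpa [hw, max_eq_left this] using hx
  have hL1 := Lp.cauchy_tendsto_of_tendsto hfm w hBs hcau hfw
  have hwi : Integrable w M := memLp_one_iff_integrable.1 <|
    Lp.memLp_of_cauchy_tendsto le_rfl (fun n => memLp_one_iff_integrable.2 (hint n)) w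
      hwm.aestronglyMeasurable hL1
  have hE : Tendsto (fun n => ∫ x, f n x ∂M) atTop (𝓝 I) := by
    have hz : Tendsto (fun n : ℕ => I + (1 / 16 : ℝ) ^ n) atTop (𝓝 (I + 0)) :=
      tendsto_const_nhds.add (tendsto_pow_atTop_nhds_zero_of_lt_one (by norm_num) (by norm_num))
    rw [add_zero] at hz
    exact tendsto_of_tendsto_of_tendsto_of_le_of_le tendsto_const_nhds hz
      (fun n => hI _ (hu n).1) fun n => (hu n).2.1
  have hvlim : ∀ v ∈ V, Tendsto (fun n => ∫ x, v x * f n x ∂M) atTop (𝓝 (∫ x, v x * w x ∂M)) := by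
    intro v hv
    obtain ⟨K, hK⟩ := hVb v hv
    refine tendsto_integral_of_L1 _
      ((hVm v hv).mul hwm).aestronglyMeasurable
      (Eventually.of_forall fun n => integrable_mul_exp_of_bdd (hum n) (hC n) (hVm v hv) hK) ?_
    simp only [eLpNorm_one_eq_lintegral_enorm] at hL1
    have h0 := ENNReal.Tendsto.const_mul (a := ENNReal.ofReal K) hL1 (Or.inr ENNReal.ofReal_ne_top)
    rw [mul_zero] at h0
    refine tendsto_of_tendsto_of_tendsto_of_le_of_le tendsto_const_nhds h0
      (fun _ => zero_le) fun n => ?_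
    simp only
    rw [← lintegral_const_mul' _ _ ENNReal.ofReal_ne_top]
    refine lintegral_mono fun x => ?_
    rw [Pi.mul_apply, Pi.sub_apply, ← mul_sub, enorm_mul, ← ofReal_norm (v x)]
    exact mul_le_mul_left (ENNReal.ofReal_le_ofReal (hK x)) _
  have hnonneg : ∀ v ∈ V, 0 ≤ ∫ x, v x * w x ∂M := by
    intro v hv
    obtain ⟨K, hK⟩ := hVb v hv
    -- Test optimality with `u n + s • v`, let `n → ∞` at fixed `s`, and only then `s → 0`.
    have key : ∀ s : ℝ, 0 < s → s * K ≤ 1 → -(s * (K ^ 2 * I)) ≤ ∫ x, v x * w x ∂M := by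
      intro s hs hsK
      have h1 : ∀ n, I ≤ ∫ x, f n x ∂M + s * ∫ x, v x * f n x ∂M
          + s ^ 2 * K ^ 2 * ∫ x, f n x ∂M := fun n =>
        (hI _ (V.add_mem (hu n).1 (V.smul_mem s hv))).trans
          (integral_exp_add_smul_le (hum n) (hC n) (hVm v hv) hK hs.le hsK)
      have h2 := ge_of_tendsto' ((hE.add ((hvlim v hv).const_mul s)).add
        (hE.const_mul (s ^ 2 * K ^ 2))) h1
      have : s * -(s * (K ^ 2 * I)) ≤ s * ∫ x, v x * w x ∂M := by nlinarith
      exact le_of_mul_le_mul_left this hs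
    have hlim : Tendsto (fun s : ℝ => -(s * (K ^ 2 * I))) (𝓝[>] 0) (𝓝 0) := by
      have : Tendsto (fun s : ℝ => -(s * (K ^ 2 * I))) (𝓝 0) (𝓝 (-(0 * (K ^ 2 * I)))) :=
        (continuous_id.mul continuous_const).neg.tendsto 0
      rw [zero_mul, neg_zero] at this
      exact this.mono_left nhdsWithin_le_nhds
    have hsK : ∀ᶠ s : ℝ in 𝓝[>] 0, s * K ≤ 1 := by
      have : Tendsto (fun s : ℝ => s * K) (𝓝 0) (𝓝 (0 * K)) :=
        (continuous_id.mul continuous_const).tendsto 0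
      rw [zero_mul] at this
      exact (this.mono_left nhdsWithin_le_nhds).eventually (eventually_le_nhds one_pos)
    refine le_of_tendsto hlim ?_
    filter_upwards [hsK, self_mem_nhdsWithin] with s h1 h2 using key s h2 h1
  have hbound : ∀ n, ∫⁻ x, ENNReal.ofReal (klFun (f n x)) ∂M ≤ ENNReal.ofReal A := by
    intro n
    have h1 : ∀ x, klFun (f n x) = u n x * Real.exp (u n x) + (1 - Real.exp (u n x)) := by
      intro x
      simp only [klFun_apply, hf, Real.log_exp]
      ring
    have hi1 := integrable_mul_exp_of_bdd (M := M) (hum n) (hC n) (hum n) (hC n)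
    have hi2 : Integrable (fun x => 1 - Real.exp (u n x)) M := (integrable_const 1).sub (hint n)
    rw [← ofReal_integral_eq_lintegral_ofReal]
    · simp only [h1]
      rw [integral_add hi1 hi2]
      exact ENNReal.ofReal_le_ofReal (by linarith [(hu n).2.2, hA _ (hu n).1])
    · simp only [h1]
      exact hi1.add hi2
    · exact ae_of_all _ fun x => klFun_nonneg (Real.exp_pos _).le
  have hfatou : ∫⁻ x, ENNReal.ofReal (klFun (w x)) ∂M ≤ ENNReal.ofReal A := by
    calc ∫⁻ x, ENNReal.ofReal (klFun (w x)) ∂M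
        = ∫⁻ x, liminf (fun n => ENNReal.ofReal (klFun (f n x))) atTop ∂M := by
          refine lintegral_congr_ae ?_
          filter_upwards [hfw] with x hx
          exact ((ENNReal.continuous_ofReal.comp continuous_klFun).tendsto _ |>.comp hx
            ).liminf_eq.symm
      _ ≤ liminf (fun n => ∫⁻ x, ENNReal.ofReal (klFun (f n x)) ∂M) atTop :=
          lintegral_liminf_le fun n => (measurable_klFun.comp (hum n).exp).ennreal_ofReal
      _ ≤ ENNReal.ofReal A := by
          refine (liminf_le_liminf (Eventually.of_forall hbound)).trans ?_
          simp
  have hkm : AEStronglyMeasurable (fun x => klFun (w x)) M :=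
    (measurable_klFun.comp hwm).aestronglyMeasurable
  have hk0 : ∀ x, 0 ≤ klFun (w x) := fun x => klFun_nonneg (hw0 x)
  have hki : Integrable (fun x => klFun (w x)) M :=
    (lintegral_ofReal_ne_top_iff_integrable hkm (ae_of_all _ hk0)).1
      (ne_top_of_le_ne_top ENNReal.ofReal_ne_top hfatou)
  refine ⟨w, hwm, hw0, hwi, fun v hv => le_antisymm ?_ (hnonneg v hv), hki, ?_⟩
  -- `V` is symmetric, so the one-sided inequality is an equality.
  · have := hnonneg _ (V.neg_mem hv)
    simp only [Pi.neg_apply, neg_mul, integral_neg] at this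
    linarith
  · rwa [← ENNReal.ofReal_le_ofReal_iff hA0,
      ofReal_integral_eq_lintegral_ofReal hki (ae_of_all _ hk0)]

end ExpMinimization

/-! ### The Kullback–Leibler entropy and its Legendre dual -/

lemma klEntropy_eq_ofReal_klFun (s : ℝ≥0) : klEntropy s = ENNReal.ofReal (klFun s) := by
  rw [klEntropy, klFun_apply]
  congr 1
  ring

/-- `F(s)/s ≥ log s - 1`, which tends to infinity. -/
lemma recession_klEntropy : recession klEntropy = ∞ := by
  refine Tendsto.limsup_eq ?_
  have h : Tendsto (fun s : ℝ≥0 => ENNReal.ofReal (Real.log s - 1)) atTop (𝓝 ∞) :=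
    ENNReal.tendsto_ofReal_atTop.comp <| tendsto_atTop_add_const_right _ _ <|
      Real.tendsto_log_atTop.comp <| NNReal.tendsto_coe_atTop.2 tendsto_id
  refine tendsto_nhds_top_mono h ?_
  filter_upwards [eventually_gt_atTop 0] with s hs
  have hs' : (0 : ℝ) < s := hs
  rw [klEntropy_eq_ofReal_klFun, ← ENNReal.ofReal_coe_nnreal, ← ENNReal.ofReal_div_of_pos hs']
  refine ENNReal.ofReal_le_ofReal ?_
  rw [klFun_apply, le_div_iff₀ hs']
  linarith

/-- Young's inequality for the Kullback-Leibler entropy function. -/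
lemma mul_le_klFun_add_exp {s : ℝ} (hs : 0 ≤ s) (x : ℝ) : s * x ≤ klFun s + (Real.exp x - 1) := by
  rcases hs.eq_or_lt with rfl | hs
  · simpa [klFun_zero] using (Real.exp_pos x).le
  · have h := Real.add_one_le_exp (x - Real.log s)
    rw [Real.exp_sub, Real.exp_log hs, le_div_iff₀ hs] at h
    rw [klFun_apply]
    linarith

/-- Young's inequality bounds the supremum, and `s = e^x` attains it. -/
lemma legendre_klEntropy_coe (x : ℝ) :
    legendre klEntropy (x : EReal) = ((Real.exp x - 1 : ℝ) : EReal) := by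
  have h : ∀ s : ℝ≥0, (((s : ℝ) : EReal) * x - ((klEntropy s : ℝ≥0∞) : EReal))
      = ((s * x - klFun s : ℝ) : EReal) := by
    intro s
    rw [klEntropy_eq_ofReal_klFun, EReal.coe_ennreal_ofReal, max_eq_left (klFun_nonneg s.coe_nonneg),
      EReal.coe_sub, EReal.coe_mul]
  simp only [legendre, h]
  refine le_antisymm (iSup_le fun s => ?_) ?_
  · exact EReal.coe_le_coe_iff.2 (by linarith [mul_le_klFun_add_exp s.coe_nonneg x])
  · refine le_iSup_of_le (NNReal.mk (Real.exp x) (Real.exp_pos x).le) (EReal.coe_le_coe_iff.2 ?_)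
    rw [NNReal.coe_mk, klFun_apply, Real.log_exp]
    linarith

/-- Only `s = 0` contributes, since `s * ⊥ = ⊥` for `s > 0` while `0 * ⊥ = 0`. -/
lemma legendre_klEntropy_bot : legendre klEntropy ⊥ = ((-1 : ℝ) : EReal) := by
  refine le_antisymm (iSup_le fun s => ?_) (le_iSup_of_le 0 ?_)
  · rcases eq_or_ne s 0 with rfl | hs
    · simp [klEntropy]
    · rw [EReal.coe_mul_bot_of_pos (by exact_mod_cast pos_iff_ne_zero.2 hs), EReal.bot_sub]
      exact bot_le
  · simp [klEntropy]

/-! ### Extended integrals and the entropy functional -/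

section Measure

variable {α : Type*} [MeasurableSpace α] {γ μ : Measure α}

lemma eintegral_congr_ae {f g : α → EReal} (h : f =ᵐ[μ] g) : eintegral μ f = eintegral μ g := by
  unfold eintegral
  rw [lintegral_congr_ae (h.mono fun x hx => congrArg EReal.toENNReal hx),
    lintegral_congr_ae (h.mono fun x hx => congrArg (fun a : EReal => (-a).toENNReal) hx)]

lemma eintegral_coe {f : α → ℝ} (hf : Integrable f μ) :
    eintegral μ (fun x => (f x : EReal)) = ((∫ x, f x ∂μ : ℝ) : EReal) := by
  have h1 : ∫⁻ x, ENNReal.ofReal (f x) ∂μ ≠ ∞ := hf.lintegral_lt_top.ne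
  have h2 : ∫⁻ x, ENNReal.ofReal (-f x) ∂μ ≠ ∞ := hf.neg.lintegral_lt_top.ne
  rw [integral_eq_lintegral_pos_part_sub_lintegral_neg_part hf, EReal.coe_sub,
    EReal.coe_ennreal_toReal h1, EReal.coe_ennreal_toReal h2]
  simp only [eintegral, ← EReal.coe_neg, EReal.real_coe_toENNReal]

lemma entropyFunctional_klEntropy_of_ac [SigmaFinite γ] [SigmaFinite μ] (h : γ ≪ μ) :
    entropyFunctional klEntropy γ μ
      = ∫⁻ x, ENNReal.ofReal (klFun (γ.rnDeriv μ x).toReal) ∂μ := by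
  rw [entropyFunctional, (Measure.singularPart_eq_zero γ μ).2 h]
  simp [klEntropy_eq_ofReal_klFun, ENNReal.coe_toNNReal_eq_toReal]

lemma entropyFunctional_klEntropy_withDensity [SigmaFinite μ] {s : α → ℝ} (hs : Measurable s)
    (hs0 : ∀ x, 0 ≤ s x) :
    entropyFunctional klEntropy (μ.withDensity fun x => ENNReal.ofReal (s x)) μ
      = ∫⁻ x, ENNReal.ofReal (klFun (s x)) ∂μ := by
  have : SigmaFinite (μ.withDensity fun x => ENNReal.ofReal (s x)) :=
    SigmaFinite.withDensity_ofReal _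
  rw [entropyFunctional_klEntropy_of_ac (withDensity_absolutelyContinuous _ _)]
  refine lintegral_congr_ae ?_
  filter_upwards [Measure.rnDeriv_withDensity μ hs.ennreal_ofReal] with x hx
  rw [hx, ENNReal.toReal_ofReal (hs0 x)]

/-- The recession constant is infinite, so finite entropy forbids a singular part and reduces to a
real integral. -/
lemma integrable_klFun_of_entropyFunctional_ne_top [SigmaFinite γ] [SigmaFinite μ]
    (h : entropyFunctional klEntropy γ μ ≠ ∞) :
    γ ≪ μ ∧ Integrable (fun x => klFun (γ.rnDeriv μ x).toReal) μ ∧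
      entropyFunctional klEntropy γ μ
        = ENNReal.ofReal (∫ x, klFun (γ.rnDeriv μ x).toReal ∂μ) := by
  have hac : γ ≪ μ := by
    rw [← Measure.singularPart_eq_zero]
    by_contra hne
    refine h ?_
    rw [entropyFunctional, recession_klEntropy, ENNReal.top_mul (by simpa using hne), add_top]
  have hnn : 0 ≤ᵐ[μ] fun x => klFun (γ.rnDeriv μ x).toReal :=
    ae_of_all _ fun x => klFun_nonneg ENNReal.toReal_nonneg
  have hm : AEStronglyMeasurable (fun x => klFun (γ.rnDeriv μ x).toReal) μ :=
    (measurable_klFun.comp (Measure.measurable_rnDeriv _ _).ennreal_toReal).aestronglyMeasurable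
  rw [entropyFunctional_klEntropy_of_ac hac] at h ⊢
  have hi := (lintegral_ofReal_ne_top_iff_integrable hm hnn).1 h
  exact ⟨hac, hi, (ofReal_integral_eq_lintegral_ofReal hi hnn).symm⟩

/-- Integrated Young inequality. -/
lemma integral_le_integral_klFun_add [IsFiniteMeasure γ] [SigmaFinite μ] (hac : γ ≪ μ)
    (hk : Integrable (fun x => klFun (γ.rnDeriv μ x).toReal) μ) {f h : α → ℝ}
    (hf : Integrable f γ) (hh : Integrable h μ)
    (hfh : ∀ᵐ x ∂μ, (γ.rnDeriv μ x).toReal * f x ≤ klFun (γ.rnDeriv μ x).toReal + h x) :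
    ∫ x, f x ∂γ ≤ ∫ x, klFun (γ.rnDeriv μ x).toReal ∂μ + ∫ x, h x ∂μ := by
  rw [← integral_rnDeriv_smul hac, ← integral_add hk hh]
  exact integral_mono_ae ((integrable_rnDeriv_smul_iff hac).2 hf) (hk.add hh) hfh

end Measure

/-! ### The cost, its Gibbs density and the admissible potentials -/

section Cost

variable {X : Type*}

/-- The Gibbs density `exp (-c / ε)`, which vanishes where `c = ∞`. -/
def gibbs (c : X → EReal) (ε : ℝ) (z : X) : ℝ :=
  if c z = ⊤ then 0 else Real.exp (-(c z).toReal / ε)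

lemma gibbs_nonneg (c : X → EReal) (ε : ℝ) (z : X) : 0 ≤ gibbs c ε z := by
  unfold gibbs
  split_ifs
  exacts [le_rfl, (Real.exp_pos _).le]

lemma le_toReal_of_coe_le {m : ℝ} {a : EReal} (h : (m : EReal) ≤ a) (ha : a ≠ ⊤) :
    m ≤ a.toReal := by
  have := EReal.toReal_le_toReal h (EReal.coe_ne_bot m) ha
  rwa [EReal.toReal_coe] at this

lemma gibbs_le {c : X → EReal} {ε : ℝ} (hε : 0 < ε) {m : ℝ} (hm : ∀ z, (m : EReal) ≤ c z) (z : X) :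
    gibbs c ε z ≤ Real.exp (-m / ε) := by
  unfold gibbs
  split_ifs with h
  · exact (Real.exp_pos _).le
  · have := le_toReal_of_coe_le (hm z) h
    exact Real.exp_le_exp.2 (by gcongr)

lemma measurable_gibbs [MeasurableSpace X] {c : X → EReal} (hc : Measurable c) (ε : ℝ) :
    Measurable (gibbs c ε) :=
  Measurable.ite (hc (measurableSet_singleton ⊤)) measurable_const (by fun_prop)

/-- The cost enters the dual integrand only through the bounded weight `e^{-c/ε}`. Where `c = ⊤`,
the value `F^*(-∞) = -1` agrees with the vanishing of this weight. -/
lemma neg_legendre_klEntropy_sub_div {c : X → EReal} {ε : ℝ} (hε : 0 < ε) {z : X} (hz : c z ≠ ⊥)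
    (a : ℝ) :
    -legendre klEntropy (((a : EReal) - c z) / (ε : EReal))
      = ((1 - gibbs c ε z * Real.exp (a / ε) : ℝ) : EReal) := by
  unfold gibbs
  split_ifs with h
  · rw [h, EReal.sub_top, EReal.bot_div_of_pos_ne_top (by exact_mod_cast hε) (EReal.coe_ne_top ε),
      legendre_klEntropy_bot, ← EReal.coe_neg]
    norm_num
  · conv_lhs => rw [← EReal.coe_toReal h hz]
    rw [← EReal.coe_sub, ← EReal.coe_div, legendre_klEntropy_coe, ← EReal.coe_neg,
      ← Real.exp_add]
    congr 1
    ring_nf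

end Cost

/-- The lower bound on `c` and finiteness of `γ` make the negative part integrable, so the only
alternative to a real integral is `⊤`. -/
lemma eintegral_eq_top_or {α : Type*} [MeasurableSpace α] (γ : Measure α) [IsFiniteMeasure γ]
    {c : α → EReal} (hc : Measurable c) {m : ℝ} (hm : ∀ z, (m : EReal) ≤ c z) :
    eintegral γ c = ⊤ ∨ ((∀ᵐ z ∂γ, c z ≠ ⊤) ∧ Integrable (fun z => (c z).toReal) γ ∧
      eintegral γ c = ((∫ z, (c z).toReal ∂γ : ℝ) : EReal)) := by
  have hm' : ∫⁻ _ : α, ENNReal.ofReal (-m) ∂γ ≠ ∞ := by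
    rw [lintegral_const]
    finiteness
  by_cases hp : ∫⁻ z, (c z).toENNReal ∂γ = ∞
  · left
    have hn : ∫⁻ z, (-c z).toENNReal ∂γ ≠ ∞ := by
      refine ne_top_of_le_ne_top (b := ∫⁻ _, ENNReal.ofReal (-m) ∂γ) hm'
        (lintegral_mono fun z => ?_)
      rw [← EReal.real_coe_toENNReal, EReal.coe_neg]
      exact EReal.toENNReal_le_toENNReal (EReal.neg_le_neg_iff.2 (hm z))
    rw [eintegral, hp, ← EReal.coe_ennreal_toReal hn, EReal.coe_ennreal_top, EReal.top_sub_coe]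
  · right
    have hfin : ∀ᵐ z ∂γ, c z ≠ ⊤ :=
      (ae_lt_top hc.ereal_toENNReal hp).mono fun z hz => EReal.toENNReal_ne_top_iff.1 hz.ne
    have hbot : ∀ z, c z ≠ ⊥ := fun z => ((EReal.bot_lt_coe m).trans_le (hm z)).ne'
    have hi : Integrable (fun z => (c z).toReal) γ := by
      have h1 : Integrable (fun z => (c z).toReal - m) γ := by
        refine (lintegral_ofReal_ne_top_iff_integrable
          (hc.ereal_toReal.sub_const m).aestronglyMeasurable ?_).1 ?_
        · filter_upwards [hfin] with z hz
          exact sub_nonneg.2 (le_toReal_of_coe_le (hm z) hz)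
        · refine ne_top_of_le_ne_top (ENNReal.add_ne_top.2 ⟨hp, hm'⟩) ?_
          rw [← lintegral_add_right _ measurable_const]
          refine lintegral_mono_ae ?_
          filter_upwards [hfin] with z hz
          rw [EReal.toENNReal_of_ne_top hz, sub_eq_add_neg]
          exact ENNReal.ofReal_add_le
      exact (h1.add (integrable_const m)).congr (ae_of_all _ fun z => sub_add_cancel _ _)
    refine ⟨hfin, hi, ?_⟩
    rw [← eintegral_coe hi]
    exact eintegral_congr_ae (hfin.mono fun z hz => (EReal.coe_toReal hz (hbot z)).symm)

/-- For this entropy the constraint is vacuous: `1 - e^{-φ}` is bounded and continuous whenever `φ`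
is. -/
lemma mem_admissible {X : Type*} [TopologicalSpace X] (φ : (X →ᵇ ℝ) × (X →ᵇ ℝ)) : φ ∈ admissible X := by
  have h : ∀ f : X →ᵇ ℝ, ∃ ψ : X →ᵇ ℝ, ∀ x,
      -legendre klEntropy ((-f x : ℝ) : EReal) = ((ψ x : ℝ) : EReal) := by
    intro f
    refine ⟨BoundedContinuousFunction.ofNormedAddCommGroup (fun x => 1 - Real.exp (-f x))
      (by fun_prop) (1 + Real.exp ‖f‖) fun x => ?_, fun x => ?_⟩
    · have h1 : Real.exp (-f x) ≤ Real.exp ‖f‖ :=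
        Real.exp_le_exp.2 ((neg_le_abs _).trans (f.norm_coe_le_norm x))
      rw [Real.norm_eq_abs, abs_le]
      constructor <;> linarith [Real.exp_pos (-f x), Real.exp_pos ‖f‖]
    · rw [legendre_klEntropy_coe, ← EReal.coe_neg, neg_sub]
      rfl
  exact ⟨h φ.1, h φ.2⟩

lemma abs_apply_le_norm {X : Type*} [TopologicalSpace X] (φ : X →ᵇ ℝ) (x : X) : |φ x| ≤ ‖φ‖ := φ.norm_coe_le_norm x

lemma abs_sum_div_le {X : Type*} [TopologicalSpace X] {ε : ℝ} (hε : 0 < ε) (φ₀ φ₁ : X →ᵇ ℝ) (z : X × X) :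
    |(φ₀ z.1 + φ₁ z.2) / ε| ≤ (‖φ₀‖ + ‖φ₁‖) / ε := by
  rw [abs_div, abs_of_pos hε]
  gcongr
  exact (abs_add_le _ _).trans (add_le_add (abs_apply_le_norm _ _) (abs_apply_le_norm _ _))

/-! ### The dual functional and weak duality -/

section Dual

variable {X : Type*} [TopologicalSpace X] [MeasurableSpace X] [OpensMeasurableSpace X]

/-- The dual functional at bounded continuous potentials, as a real number. -/
def dualValue (c : X × X → EReal) (ε : ℝ) (μ₀ μ₁ : FiniteMeasure X) (ν : FiniteMeasure (X × X))
    (φ₀ φ₁ : X →ᵇ ℝ) : ℝ :=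
  ∫ x, (1 - Real.exp (-φ₀ x)) ∂(μ₀ : Measure X) + ∫ x, (1 - Real.exp (-φ₁ x)) ∂(μ₁ : Measure X)
    + ε * ∫ z, (1 - gibbs c ε z * Real.exp ((φ₀ z.1 + φ₁ z.2) / ε)) ∂(ν : Measure (X × X))

lemma measurable_boundedContinuousFunction (φ : X →ᵇ ℝ) : Measurable φ := φ.continuous.measurable

lemma integrable_exp_neg (μ : Measure X) [IsFiniteMeasure μ] (φ : X →ᵇ ℝ) :
    Integrable (fun x => Real.exp (-φ x)) μ :=
  integrable_exp_of_bdd (measurable_boundedContinuousFunction φ).neg (C := ‖φ‖)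
    fun x => by rw [abs_neg]; exact abs_apply_le_norm φ x

lemma measurable_sum_div (ε : ℝ) (φ₀ φ₁ : X →ᵇ ℝ) :
    Measurable fun z : X × X => (φ₀ z.1 + φ₁ z.2) / ε :=
  (((measurable_boundedContinuousFunction φ₀).comp measurable_fst).add
    ((measurable_boundedContinuousFunction φ₁).comp measurable_snd)).div_const ε

lemma integrable_gibbs_mul_exp (ν : Measure (X × X)) [IsFiniteMeasure ν] {c : X × X → EReal}
    (hc : Measurable c) {m : ℝ} (hm : ∀ z, (m : EReal) ≤ c z) {ε : ℝ} (hε : 0 < ε)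
    (φ₀ φ₁ : X →ᵇ ℝ) :
    Integrable (fun z => gibbs c ε z * Real.exp ((φ₀ z.1 + φ₁ z.2) / ε)) ν := by
  refine (integrable_exp_of_bdd (measurable_sum_div ε φ₀ φ₁) (abs_sum_div_le hε φ₀ φ₁)).bdd_mul
    (c := Real.exp (-m / ε)) (measurable_gibbs hc ε).aestronglyMeasurable (ae_of_all _ fun z => ?_)
  rw [Real.norm_eq_abs, abs_of_nonneg (gibbs_nonneg c ε z)]
  exact gibbs_le hε hm z

lemma dualReg_eq_dualValue {c : X × X → EReal} (hc : Measurable c) {m : ℝ}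
    (hm : ∀ z, (m : EReal) ≤ c z) {ε : ℝ} (hε : 0 < ε) (μ₀ μ₁ : FiniteMeasure X)
    (ν : FiniteMeasure (X × X)) (φ₀ φ₁ : X →ᵇ ℝ) :
    dualReg c ε μ₀ μ₁ ν φ₀ φ₁ = (dualValue c ε μ₀ μ₁ ν φ₀ φ₁ : EReal) := by
  have hbot : ∀ z, c z ≠ ⊥ := fun z => ((EReal.bot_lt_coe m).trans_le (hm z)).ne'
  have h : ∀ a : ℝ, -legendre klEntropy ((-a : ℝ) : EReal) = ((1 - Real.exp (-a) : ℝ) : EReal) := by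
    intro a
    rw [legendre_klEntropy_coe, ← EReal.coe_neg, neg_sub]
  simp only [dualReg, h, neg_legendre_klEntropy_sub_div hε (hbot _)]
  have h0 := eintegral_coe (f := fun x => 1 - Real.exp (-φ₀ x))
    ((integrable_const _).sub (integrable_exp_neg (μ₀ : Measure X) φ₀))
  have h1 := eintegral_coe (f := fun x => 1 - Real.exp (-φ₁ x))
    ((integrable_const _).sub (integrable_exp_neg (μ₁ : Measure X) φ₁))
  have h2 := eintegral_coe
    (f := fun z : X × X => 1 - gibbs c ε z * Real.exp ((φ₀ z.1 + φ₁ z.2) / ε))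
    ((integrable_const _).sub
      (integrable_gibbs_mul_exp (ν : Measure (X × X)) hc hm hε φ₀ φ₁))
  rw [h0, h1, h2]
  simp only [dualValue, EReal.coe_add, EReal.coe_mul]

/-- The Young inequality for a marginal. -/
lemma neg_integral_comp_le {Y : Type*} [MeasurableSpace Y] {γ : Measure Y} [IsFiniteMeasure γ]
    {π : Y → X} (hπ : Measurable π) {μ : Measure X} [IsFiniteMeasure μ] (φ : X →ᵇ ℝ)
    (hac : γ.map π ≪ μ)
    (hk : Integrable (fun x => klFun ((γ.map π).rnDeriv μ x).toReal) μ) :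
    ∫ x, (1 - Real.exp (-φ x)) ∂μ ≤
      ∫ x, klFun ((γ.map π).rnDeriv μ x).toReal ∂μ + ∫ y, φ (π y) ∂γ := by
  have h := integral_le_integral_klFun_add hac hk (f := fun x => -φ x)
    (h := fun x => Real.exp (-φ x) - 1) (φ.integrable _).neg
    ((integrable_exp_neg _ φ).sub (integrable_const _))
    (ae_of_all _ fun x => mul_le_klFun_add_exp ENNReal.toReal_nonneg _)
  rw [integral_neg, integral_map hπ.aemeasurable φ.continuous.measurable.aestronglyMeasurable] at h
  have h2 : ∫ x, (Real.exp (-φ x) - 1) ∂μ = -∫ x, (1 - Real.exp (-φ x)) ∂μ := by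
    rw [← integral_neg]
    simp only [neg_sub]
  linarith

/-- Weak duality. -/
lemma dualValue_le_primalReg {c : X × X → EReal} (hc : Measurable c) {m : ℝ}
    (hm : ∀ z, (m : EReal) ≤ c z) {ε : ℝ} (hε : 0 < ε) (μ₀ μ₁ : FiniteMeasure X)
    (ν γ : FiniteMeasure (X × X)) (φ₀ φ₁ : X →ᵇ ℝ) :
    (dualValue c ε μ₀ μ₁ ν φ₀ φ₁ : EReal) ≤ primalReg c ε μ₀ μ₁ ν γ := by
  unfold primalReg primal
  -- No term of the primal functional is `⊥`, so one infinite term makes it `⊤`; afterwards all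
  -- terms are real.
  have hεnb : ∀ a : ℝ≥0∞, (ε : EReal) * (a : EReal) ≠ ⊥ := fun a =>
    (EReal.bot_lt_zero.trans_le
      (mul_nonneg (by exact_mod_cast hε.le) (EReal.coe_ennreal_nonneg a))).ne'
  set E₀ := entropyFunctional klEntropy ((γ : Measure (X × X)).map Prod.fst) (μ₀ : Measure X)
    with hE₀
  set E₁ := entropyFunctional klEntropy ((γ : Measure (X × X)).map Prod.snd) (μ₁ : Measure X)
    with hE₁
  set E := entropyFunctional klEntropy (γ : Measure (X × X)) (ν : Measure (X × X)) with hE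
  rcases eintegral_eq_top_or (γ : Measure (X × X)) hc hm with h | ⟨hfin, hci, h⟩
  · rw [h, EReal.add_top_of_ne_bot, EReal.top_add_of_ne_bot (hεnb _)]
    · exact le_top
    · rw [← EReal.coe_ennreal_add]
      exact EReal.coe_ennreal_ne_bot _
  rw [h]
  by_cases h0 : E₀ = ∞
  · rw [h0, EReal.coe_ennreal_top, EReal.top_add_of_ne_bot (EReal.coe_ennreal_ne_bot _),
      EReal.top_add_of_ne_bot (EReal.coe_ne_bot _), EReal.top_add_of_ne_bot (hεnb _)]
    exact le_top
  by_cases h1 : E₁ = ∞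
  · rw [h1, EReal.coe_ennreal_top, EReal.add_top_of_ne_bot (EReal.coe_ennreal_ne_bot _),
      EReal.top_add_of_ne_bot (EReal.coe_ne_bot _), EReal.top_add_of_ne_bot (hεnb _)]
    exact le_top
  by_cases h2 : E = ∞
  · rw [h2, EReal.coe_ennreal_top, EReal.coe_mul_top_of_pos hε, EReal.add_top_of_ne_bot]
    · exact le_top
    · rw [← EReal.coe_ennreal_toReal h0, ← EReal.coe_ennreal_toReal h1]
      exact EReal.coe_ne_bot _
  obtain ⟨ac0, hk0, e0⟩ := integrable_klFun_of_entropyFunctional_ne_top h0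
  obtain ⟨ac1, hk1, e1⟩ := integrable_klFun_of_entropyFunctional_ne_top h1
  obtain ⟨ac, hk, e⟩ := integrable_klFun_of_entropyFunctional_ne_top h2
  have hnn : ∀ {α : Type _} [MeasurableSpace α] (γ μ : Measure α),
      0 ≤ ∫ x, klFun (γ.rnDeriv μ x).toReal ∂μ := fun γ μ =>
    integral_nonneg fun x => klFun_nonneg ENNReal.toReal_nonneg
  rw [hE₀, hE₁, hE, e0, e1, e]
  simp only [EReal.coe_ennreal_ofReal]
  rw [max_eq_left (hnn _ _), max_eq_left (hnn _ _), max_eq_left (integral_nonneg fun x =>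
    klFun_nonneg ENNReal.toReal_nonneg)]
  rw [← EReal.coe_add, ← EReal.coe_add, ← EReal.coe_mul, ← EReal.coe_add, EReal.coe_le_coe_iff]
  have y0 := neg_integral_comp_le measurable_fst φ₀ ac0 hk0
  have y1 := neg_integral_comp_le measurable_snd φ₁ ac1 hk1
  -- Finiteness of `c` holds `γ`-a.e., hence `ν`-a.e. only where the density of `γ` is nonzero;
  -- elsewhere Young's inequality is checked directly with `F(0) = 1`.
  have hcr : ∀ᵐ z ∂(ν : Measure (X × X)),
      (γ : Measure (X × X)).rnDeriv ν z ≠ 0 → c z ≠ ⊤ := by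
    rw [← ae_withDensity_iff (Measure.measurable_rnDeriv _ _),
      Measure.withDensity_rnDeriv_eq _ _ ac]
    exact hfin
  have i0 : Integrable (fun z : X × X => φ₀ z.1) (γ : Measure (X × X)) :=
    integrable_of_bdd (φ₀.continuous.measurable.comp measurable_fst)
      fun z => abs_apply_le_norm φ₀ z.1
  have i1 : Integrable (fun z : X × X => φ₁ z.2) (γ : Measure (X × X)) :=
    integrable_of_bdd (φ₁.continuous.measurable.comp measurable_snd)
      fun z => abs_apply_le_norm φ₁ z.2
  have i01 : Integrable (fun z : X × X => φ₀ z.1 + φ₁ z.2) (γ : Measure (X × X)) := i0.add i1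
  have y := integral_le_integral_klFun_add ac hk
    (f := fun z => (φ₀ z.1 + φ₁ z.2 - (c z).toReal) / ε)
    (h := fun z => -(1 - gibbs c ε z * Real.exp ((φ₀ z.1 + φ₁ z.2) / ε)))
    ((i01.sub hci).div_const ε)
    ((integrable_const _).sub (integrable_gibbs_mul_exp _ hc hm hε φ₀ φ₁)).neg
    (by
      filter_upwards [hcr] with z hz
      by_cases h0 : (γ : Measure (X × X)).rnDeriv ν z = 0
      · rw [h0, ENNReal.toReal_zero, zero_mul, klFun_zero]
        have := mul_nonneg (gibbs_nonneg c ε z) (Real.exp_pos ((φ₀ z.1 + φ₁ z.2) / ε)).le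
        linarith
      · have := mul_le_klFun_add_exp (s := ((γ : Measure (X × X)).rnDeriv ν z).toReal)
          ENNReal.toReal_nonneg ((φ₀ z.1 + φ₁ z.2 - (c z).toReal) / ε)
        rw [gibbs, if_neg (hz h0), ← Real.exp_add, ← add_div, neg_add_eq_sub]
        linarith)
  rw [integral_neg, integral_div, integral_sub i01 hci, integral_add i0 i1, div_le_iff₀ hε] at y
  unfold dualValue
  -- Adding `y0`, `y1` and `y` cancels the integrals of `φ₀` and `φ₁` against `γ`.
  linarith

end Dual

/-! ### Integration on a disjoint union -/

section DisjointUnion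

variable {α β : Type*} [MeasurableSpace α] [MeasurableSpace β]

lemma measurableEmbedding_inl : MeasurableEmbedding (Sum.inl : α → α ⊕ β) :=
  ⟨Sum.inl_injective, measurable_inl, fun _ hs => measurableSet_inl_image.2 hs⟩

lemma measurableEmbedding_inr : MeasurableEmbedding (Sum.inr : β → α ⊕ β) :=
  ⟨Sum.inr_injective, measurable_inr, fun _ hs => measurableSet_inr_image.2 hs⟩

/-- The measure on a disjoint union given by a measure on each part. -/
def sumMeasure (μ : Measure α) (ν : Measure β) : Measure (α ⊕ β) :=
  μ.map Sum.inl + ν.map Sum.inr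

instance (μ : Measure α) (ν : Measure β) [IsFiniteMeasure μ] [IsFiniteMeasure ν] :
    IsFiniteMeasure (sumMeasure μ ν) := by
  unfold sumMeasure
  infer_instance

lemma integrable_sumMeasure_iff {μ : Measure α} {ν : Measure β} {f : α ⊕ β → ℝ} :
    Integrable f (sumMeasure μ ν) ↔
      Integrable (fun x => f (Sum.inl x)) μ ∧ Integrable (fun y => f (Sum.inr y)) ν := by
  rw [sumMeasure, integrable_add_measure, measurableEmbedding_inl.integrable_map_iff,
    measurableEmbedding_inr.integrable_map_iff]
  rfl

lemma integral_sumMeasure {μ : Measure α} {ν : Measure β} {f : α ⊕ β → ℝ}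
    (hf : Integrable f (sumMeasure μ ν)) :
    ∫ z, f z ∂(sumMeasure μ ν) = ∫ x, f (Sum.inl x) ∂μ + ∫ y, f (Sum.inr y) ∂ν := by
  have hf' := hf
  rw [sumMeasure, integrable_add_measure] at hf'
  rw [sumMeasure, integral_add_measure hf'.1 hf'.2, measurableEmbedding_inl.integral_map,
    measurableEmbedding_inr.integral_map]

end DisjointUnion

/-! ### The primal functional in Gibbs coordinates -/

section Primal

/-- Pointwise, `c g + ε F(g)` is the entropy relative to the Gibbs density up to a constant. -/
lemma toReal_mul_add_klFun_gibbs {X : Type*} (c : X → EReal) {ε : ℝ} (hε : 0 < ε) (z : X)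
    {g : ℝ} (hg : 0 ≤ g) :
    (c z).toReal * (gibbs c ε z * g) + ε * klFun (gibbs c ε z * g)
      = ε * gibbs c ε z * klFun g + ε * (1 - gibbs c ε z) := by
  unfold gibbs
  split_ifs with h
  · simp [klFun_zero]
  · rcases hg.eq_or_lt with rfl | hg
    · simp only [mul_zero, klFun_zero]
      ring
    · rw [klFun_apply, klFun_apply, Real.log_mul (Real.exp_pos _).ne' hg.ne', Real.log_exp]
      field_simp
      ring

/-- The direction in the disjoint union `X ⊕ (X ⊕ X × X)` determined by a pair of potentials. -/
def potentialMap (X : Type*) [TopologicalSpace X] (ε : ℝ) :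
    ((X →ᵇ ℝ) × (X →ᵇ ℝ)) →ₗ[ℝ] (X ⊕ (X ⊕ X × X) → ℝ) where
  toFun φ := Sum.elim (fun x => -φ.1 x)
    (Sum.elim (fun x => -φ.2 x) fun z => (φ.1 z.1 + φ.2 z.2) / ε)
  map_add' φ ψ := by
    ext (x | x | z)
    · simp [add_comm]
    · simp [add_comm]
    · simp only [Sum.elim_inr, Prod.fst_add, Prod.snd_add, Pi.add_apply,
        BoundedContinuousFunction.coe_add]
      ring
  map_smul' a φ := by
    ext (x | x | z)
    · simp
    · simp
    · simp only [Sum.elim_inr, Prod.smul_fst, Prod.smul_snd, Pi.smul_apply, smul_eq_mul,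
        BoundedContinuousFunction.coe_smul, RingHom.id_apply]
      ring

lemma abs_potentialMap_le {X : Type*} [TopologicalSpace X] {ε : ℝ} (hε : 0 < ε) (φ : (X →ᵇ ℝ) × (X →ᵇ ℝ))
    (y : X ⊕ (X ⊕ X × X)) :
    |potentialMap X ε φ y| ≤ ‖φ.1‖ + ‖φ.2‖ + (‖φ.1‖ + ‖φ.2‖) / ε := by
  have h0 : 0 ≤ (‖φ.1‖ + ‖φ.2‖) / ε := by positivity
  rcases y with x | x | z
  · have := abs_apply_le_norm φ.1 x
    change |-φ.1 x| ≤ _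
    rw [abs_neg]
    linarith [norm_nonneg φ.2]
  · have := abs_apply_le_norm φ.2 x
    change |-φ.2 x| ≤ _
    rw [abs_neg]
    linarith [norm_nonneg φ.1]
  · have := abs_sum_div_le hε φ.1 φ.2 z
    change |(φ.1 z.1 + φ.2 z.2) / ε| ≤ _
    linarith [norm_nonneg φ.1, norm_nonneg φ.2]

/-- The primal functional of a measure with density `exp (-c / ε) g` whose marginals have the
densities `s₀`, `s₁`. -/
lemma primalReg_withDensity {X : Type*} [MeasurableSpace X] {c : X × X → EReal} (hc : Measurable c) {m : ℝ}
    (hm : ∀ z, (m : EReal) ≤ c z) {ε : ℝ} (hε : 0 < ε) (μ₀ μ₁ : FiniteMeasure X)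
    (ν γ : FiniteMeasure (X × X)) {s₀ s₁ : X → ℝ} {g : X × X → ℝ}
    (hs₀ : Measurable s₀) (hs₀' : ∀ x, 0 ≤ s₀ x)
    (hk₀ : Integrable (fun x => klFun (s₀ x)) (μ₀ : Measure X))
    (hs₁ : Measurable s₁) (hs₁' : ∀ x, 0 ≤ s₁ x)
    (hk₁ : Integrable (fun x => klFun (s₁ x)) (μ₁ : Measure X))
    (hg : Measurable g) (hg' : ∀ z, 0 ≤ g z)
    (hGi : Integrable (fun z => gibbs c ε z * g z) (ν : Measure (X × X)))
    (hk : Integrable (fun z => ε * gibbs c ε z * klFun (g z)) (ν : Measure (X × X)))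
    (hγ : (γ : Measure (X × X)) =
      (ν : Measure (X × X)).withDensity fun z => ENNReal.ofReal (gibbs c ε z * g z))
    (h₀ : (γ : Measure (X × X)).map Prod.fst =
      (μ₀ : Measure X).withDensity fun x => ENNReal.ofReal (s₀ x))
    (h₁ : (γ : Measure (X × X)).map Prod.snd =
      (μ₁ : Measure X).withDensity fun x => ENNReal.ofReal (s₁ x)) :
    primalReg c ε μ₀ μ₁ ν γ = ((∫ x, klFun (s₀ x) ∂(μ₀ : Measure X)
      + ∫ x, klFun (s₁ x) ∂(μ₁ : Measure X)
      + ∫ z, ε * gibbs c ε z * klFun (g z) ∂(ν : Measure (X × X))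
      + ε * ∫ z, (1 - gibbs c ε z) ∂(ν : Measure (X × X)) : ℝ) : EReal) := by
  have hbot : ∀ z, c z ≠ ⊥ := fun z => ((EReal.bot_lt_coe m).trans_le (hm z)).ne'
  have hdm := measurable_gibbs hc ε
  have hGm : Measurable fun z => gibbs c ε z * g z := hdm.mul hg
  have hG0 : ∀ z, 0 ≤ gibbs c ε z * g z := fun z => mul_nonneg (gibbs_nonneg c ε z) (hg' z)
  have hdi : Integrable (gibbs c ε) (ν : Measure (X × X)) :=
    integrable_of_bdd hdm (C := Real.exp (-m / ε)) fun z => by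
      rw [abs_of_nonneg (gibbs_nonneg c ε z)]
      exact gibbs_le hε hm z
  have hdi' : Integrable (fun z => ε * (1 - gibbs c ε z)) (ν : Measure (X × X)) :=
    ((integrable_const 1).sub hdi).const_mul ε
  have hid := fun z => toReal_mul_add_klFun_gibbs c hε z (hg' z)
  have hci : Integrable (fun z => (c z).toReal * (gibbs c ε z * g z)) (ν : Measure (X × X)) := by
    -- `c` is not bounded above: the upper bound drops the nonnegative entropy term from the
    -- identity `hid`, the lower one uses `m ≤ c`.
    refine Integrable.mono' ((hk.add hdi').abs.add (hGi.const_mul |m|))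
      (hc.ereal_toReal.mul hGm).aestronglyMeasurable (ae_of_all _ fun z => ?_)
    have h1 : 0 ≤ ε * klFun (gibbs c ε z * g z) := mul_nonneg hε.le (klFun_nonneg (hG0 z))
    have h2 : -(|m| * (gibbs c ε z * g z)) ≤ (c z).toReal * (gibbs c ε z * g z) := by
      by_cases h : c z = ⊤
      · simp [gibbs, h]
      · rw [← neg_mul]
        exact mul_le_mul_of_nonneg_right
          ((neg_abs_le m).trans (le_toReal_of_coe_le (hm z) h)) (hG0 z)
    have h3 : 0 ≤ |m| * (gibbs c ε z * g z) := mul_nonneg (abs_nonneg _) (hG0 z)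
    have h4 := le_abs_self (ε * gibbs c ε z * klFun (g z) + ε * (1 - gibbs c ε z))
    have h5 := abs_nonneg (ε * gibbs c ε z * klFun (g z) + ε * (1 - gibbs c ε z))
    rw [Real.norm_eq_abs, abs_le]
    simp only [Pi.add_apply]
    constructor <;> linarith [hid z]
  have hki : Integrable (fun z => ε * klFun (gibbs c ε z * g z)) (ν : Measure (X × X)) :=
    ((hk.add hdi').sub hci).congr (ae_of_all _ fun z => by
      simp only [Pi.add_apply, Pi.sub_apply]
      linarith [hid z])
  have hki' : Integrable (fun z => klFun (gibbs c ε z * g z)) (ν : Measure (X × X)) :=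
    (integrable_const_mul_iff (isUnit_iff_ne_zero.2 hε.ne') _).1 hki
  have hcγ : eintegral (γ : Measure (X × X)) c
      = ((∫ z, (c z).toReal * (gibbs c ε z * g z) ∂(ν : Measure (X × X)) : ℝ) : EReal) := by
    have hfin : c =ᵐ[(γ : Measure (X × X))] fun z => ((c z).toReal : EReal) := by
      rw [hγ, EventuallyEq, ae_withDensity_iff hGm.ennreal_ofReal]
      refine ae_of_all _ fun z hz => (EReal.coe_toReal (fun h => hz ?_) (hbot z)).symm
      simp [gibbs, h]
    have hi : Integrable (fun z => (c z).toReal) (γ : Measure (X × X)) := by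
      rw [hγ, integrable_withDensity_iff_integrable_smul' hGm.ennreal_ofReal (by simp)]
      refine hci.congr (ae_of_all _ fun z => ?_)
      beta_reduce
      rw [ENNReal.toReal_ofReal (hG0 z), smul_eq_mul, mul_comm]
    rw [eintegral_congr_ae hfin, eintegral_coe hi, hγ,
      integral_withDensity_eq_integral_toReal_smul hGm.ennreal_ofReal (by simp)]
    simp only [ENNReal.toReal_ofReal (hG0 _), smul_eq_mul, mul_comm (gibbs c ε _ * g _)]
  have hent : ∀ {Y : Type _} [MeasurableSpace Y] {μ : Measure Y} [IsFiniteMeasure μ] {s : Y → ℝ},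
      Measurable s → (∀ y, 0 ≤ s y) → Integrable (fun y => klFun (s y)) μ →
      ((entropyFunctional klEntropy (μ.withDensity fun y => ENNReal.ofReal (s y)) μ : ℝ≥0∞) : EReal)
        = ((∫ y, klFun (s y) ∂μ : ℝ) : EReal) := by
    intro Y _ μ _ s hs hs0 hi
    have h0 : ∀ y, 0 ≤ klFun (s y) := fun y => klFun_nonneg (hs0 y)
    rw [entropyFunctional_klEntropy_withDensity hs hs0,
      ← ofReal_integral_eq_lintegral_ofReal hi (ae_of_all _ h0), EReal.coe_ennreal_ofReal,
      max_eq_left (integral_nonneg h0)]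
  rw [primalReg, primal, h₀, h₁, hcγ, hγ, hent hs₀ hs₀' hk₀, hent hs₁ hs₁' hk₁, hent hGm hG0 hki',
    ← EReal.coe_add, ← EReal.coe_add, ← EReal.coe_mul, ← EReal.coe_add, EReal.coe_eq_coe_iff,
    ← integral_const_mul, ← integral_const_mul, add_assoc, ← integral_add hci hki,
    add_assoc _ _ (∫ z, ε * (1 - gibbs c ε z) ∂_), ← integral_add hk hdi']
  simp only [hid]

variable {X : Type*} [TopologicalSpace X] [MeasurableSpace X] [BorelSpace X]

lemma measurable_potentialMap (ε : ℝ) (φ : (X →ᵇ ℝ) × (X →ᵇ ℝ)) :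
    Measurable (potentialMap X ε φ) :=
  (measurable_boundedContinuousFunction φ.1).neg.sumElim
    ((measurable_boundedContinuousFunction φ.2).neg.sumElim (measurable_sum_div ε φ.1 φ.2))

/-- A measure with density `s` is determined by its integrals against bounded continuous
functions. -/
lemma map_withDensity_eq_withDensity [HasOuterApproxClosed X] {Y : Type*} [MeasurableSpace Y]
    {π : Y → X}
    (hπ : Measurable π) {ν : Measure Y} {μ : Measure X} {G : Y → ℝ} {s : X → ℝ}
    (hG : Measurable G) (hG0 : ∀ y, 0 ≤ G y) (hGi : Integrable G ν)
    (hs : Measurable s) (hs0 : ∀ x, 0 ≤ s x) (hsi : Integrable s μ)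
    (h : ∀ f : X →ᵇ ℝ, ∫ y, G y * f (π y) ∂ν = ∫ x, s x * f x ∂μ) :
    (ν.withDensity fun y => ENNReal.ofReal (G y)).map π
      = μ.withDensity fun x => ENNReal.ofReal (s x) := by
  have := isFiniteMeasure_withDensity_ofReal hGi.2
  have := isFiniteMeasure_withDensity_ofReal hsi.2
  refine ext_of_forall_integral_eq_of_IsFiniteMeasure fun f => ?_
  rw [integral_map hπ.aemeasurable f.continuous.measurable.aestronglyMeasurable,
    integral_withDensity_eq_integral_toReal_smul hG.ennreal_ofReal (by simp),
    integral_withDensity_eq_integral_toReal_smul hs.ennreal_ofReal (by simp)]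
  simp only [ENNReal.toReal_ofReal (hG0 _), ENNReal.toReal_ofReal (hs0 _), smul_eq_mul]
  exact h f

end Primal

/-! ### Strong duality -/

section StrongDuality

variable {X : Type*} [TopologicalSpace X] [MeasurableSpace X] [BorelSpace X]

/-- The dual functional is the integral of `1 - exp` over the disjoint union, up to a constant. -/
lemma dualValue_eq_integral_potentialMap {c : X × X → EReal} (hc : Measurable c) {m : ℝ}
    (hm : ∀ z, (m : EReal) ≤ c z) {ε : ℝ} (hε : 0 < ε) (μ₀ μ₁ : FiniteMeasure X)
    (ν : FiniteMeasure (X × X))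
    [IsFiniteMeasure ((ν : Measure (X × X)).withDensity fun z => ENNReal.ofReal (ε * gibbs c ε z))]
    (φ : (X →ᵇ ℝ) × (X →ᵇ ℝ)) :
    dualValue c ε μ₀ μ₁ ν φ.1 φ.2 =
      ∫ y, (1 - Real.exp (potentialMap X ε φ y)) ∂(sumMeasure (μ₀ : Measure X)
        (sumMeasure (μ₁ : Measure X)
          ((ν : Measure (X × X)).withDensity fun z => ENNReal.ofReal (ε * gibbs c ε z))))
      + ε * ∫ z, (1 - gibbs c ε z) ∂(ν : Measure (X × X)) := by
  have hdm := measurable_gibbs hc ε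
  have hd0 : ∀ z, 0 ≤ ε * gibbs c ε z := fun z => mul_nonneg hε.le (gibbs_nonneg c ε z)
  have hdi : Integrable (gibbs c ε) (ν : Measure (X × X)) := by
    simpa using integrable_gibbs_mul_exp (ν : Measure (X × X)) hc hm hε 0 0
  have hei := integrable_gibbs_mul_exp (ν : Measure (X × X)) hc hm hε φ.1 φ.2
  have hi : Integrable (fun y => 1 - Real.exp (potentialMap X ε φ y))
      (sumMeasure (μ₀ : Measure X) (sumMeasure (μ₁ : Measure X)
        ((ν : Measure (X × X)).withDensity fun z => ENNReal.ofReal (ε * gibbs c ε z)))) :=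
    (integrable_const 1).sub
      (integrable_exp_of_bdd (measurable_potentialMap ε φ) (abs_potentialMap_le hε φ))
  rw [integral_sumMeasure hi, integral_sumMeasure (integrable_sumMeasure_iff.1 hi).2,
    integral_withDensity_eq_integral_toReal_smul (hdm.const_mul ε).ennreal_ofReal (by simp)]
  simp only [ENNReal.toReal_ofReal (hd0 _), smul_eq_mul, potentialMap, LinearMap.coe_mk,
    AddHom.coe_mk, Sum.elim_inl, Sum.elim_inr]
  have h1 : Integrable (fun z => ε * gibbs c ε z
      * (1 - Real.exp ((φ.1 z.1 + φ.2 z.2) / ε))) (ν : Measure (X × X)) :=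
    ((hdi.sub hei).const_mul ε).congr (ae_of_all _ fun z => by
      simp only [Pi.sub_apply]
      ring)
  have h2 : Integrable (fun z => ε * (1 - gibbs c ε z)) (ν : Measure (X × X)) :=
    ((integrable_const 1).sub hdi).const_mul ε
  rw [dualValue, ← integral_const_mul, ← integral_const_mul, add_assoc, add_assoc, add_assoc,
    ← integral_add h1 h2]
  congr 3
  ext z
  ring

/-- Strong duality: the primal functional attains every upper bound of the dual functional. -/
lemma exists_primalReg_le [HasOuterApproxClosed X] {c : X × X → EReal} (hc : Measurable c) {m : ℝ}
    (hm : ∀ z, (m : EReal) ≤ c z) {ε : ℝ} (hε : 0 < ε) (μ₀ μ₁ : FiniteMeasure X)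
    (ν : FiniteMeasure (X × X)) {A : ℝ} (hA : ∀ φ₀ φ₁, dualValue c ε μ₀ μ₁ ν φ₀ φ₁ ≤ A) :
    ∃ γ : FiniteMeasure (X × X), primalReg c ε μ₀ μ₁ ν γ ≤ (A : EReal) := by
  have hdm := measurable_gibbs hc ε
  have hd0 : ∀ z, 0 ≤ ε * gibbs c ε z := fun z => mul_nonneg hε.le (gibbs_nonneg c ε z)
  have hdi : Integrable (gibbs c ε) (ν : Measure (X × X)) := by
    simpa using integrable_gibbs_mul_exp (ν : Measure (X × X)) hc hm hε 0 0
  have hdε : Measurable fun z => ENNReal.ofReal (ε * gibbs c ε z) :=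
    (hdm.const_mul ε).ennreal_ofReal
  have := isFiniteMeasure_withDensity_ofReal (hdi.const_mul ε).2
  obtain ⟨w, hwm, hw0, hwi, hwV, hki, hk⟩ := exists_density_integral_klFun_le
    (M := sumMeasure (μ₀ : Measure X) (sumMeasure (μ₁ : Measure X)
      ((ν : Measure (X × X)).withDensity fun z => ENNReal.ofReal (ε * gibbs c ε z))))
    (LinearMap.range (potentialMap X ε))
    (by rintro _ ⟨φ, rfl⟩; exact measurable_potentialMap ε φ)
    (by rintro _ ⟨φ, rfl⟩; exact ⟨_, abs_potentialMap_le hε φ⟩)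
    -- The additive constant between the dual value and `∫ (1 - exp v) dM`; it reappears in
    -- `primalReg_withDensity`.
    (A := A - ε * ∫ z, (1 - gibbs c ε z) ∂(ν : Measure (X × X)))
    (by
      rintro _ ⟨φ, rfl⟩
      have h := dualValue_eq_integral_potentialMap hc hm hε μ₀ μ₁ ν φ
      linarith [hA φ.1 φ.2])
  obtain ⟨hwi₀, hwi'⟩ := integrable_sumMeasure_iff.1 hwi
  obtain ⟨hwi₁, hwi₂⟩ := integrable_sumMeasure_iff.1 hwi'
  obtain ⟨hki₀, hki'⟩ := integrable_sumMeasure_iff.1 hki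
  obtain ⟨hki₁, hki₂⟩ := integrable_sumMeasure_iff.1 hki'
  rw [integrable_withDensity_iff_integrable_smul' hdε (by simp)] at hwi₂ hki₂
  simp only [ENNReal.toReal_ofReal (hd0 _), smul_eq_mul] at hwi₂ hki₂
  rw [integral_sumMeasure hki, integral_sumMeasure hki',
    integral_withDensity_eq_integral_toReal_smul hdε (by simp)] at hk
  simp only [ENNReal.toReal_ofReal (hd0 _), smul_eq_mul] at hk
  have hGi : Integrable (fun z => gibbs c ε z * w (Sum.inr (Sum.inr z))) (ν : Measure (X × X)) := by
    simp only [mul_assoc] at hwi₂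
    exact (integrable_const_mul_iff (isUnit_iff_ne_zero.2 hε.ne') _).1 hwi₂
  have hG0 : ∀ z, 0 ≤ gibbs c ε z * w (Sum.inr (Sum.inr z)) := fun z =>
    mul_nonneg (gibbs_nonneg c ε z) (hw0 _)
  have hm₀ : Measurable fun x => w (Sum.inl x) := hwm.comp measurable_inl
  have hm₁ : Measurable fun x => w (Sum.inr (Sum.inl x)) :=
    hwm.comp (measurable_inr.comp measurable_inl)
  have hm₂ : Measurable fun z => w (Sum.inr (Sum.inr z)) :=
    hwm.comp (measurable_inr.comp measurable_inr)
  have hmarg : ∀ φ : (X →ᵇ ℝ) × (X →ᵇ ℝ),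
      ∫ z, gibbs c ε z * w (Sum.inr (Sum.inr z)) * (φ.1 z.1 + φ.2 z.2) ∂(ν : Measure (X × X))
        = ∫ x, w (Sum.inl x) * φ.1 x ∂(μ₀ : Measure X)
          + ∫ x, w (Sum.inr (Sum.inl x)) * φ.2 x ∂(μ₁ : Measure X) := by
    intro φ
    have h := hwV _ ⟨φ, rfl⟩
    have hi : Integrable (fun y => potentialMap X ε φ y * w y)
        (sumMeasure (μ₀ : Measure X) (sumMeasure (μ₁ : Measure X)
          ((ν : Measure (X × X)).withDensity fun z => ENNReal.ofReal (ε * gibbs c ε z)))) :=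
      hwi.bdd_mul (measurable_potentialMap ε φ).aestronglyMeasurable
        (ae_of_all _ (abs_potentialMap_le hε φ))
    rw [integral_sumMeasure hi, integral_sumMeasure (integrable_sumMeasure_iff.1 hi).2,
      integral_withDensity_eq_integral_toReal_smul hdε (by simp)] at h
    simp only [ENNReal.toReal_ofReal (hd0 _), smul_eq_mul, potentialMap, LinearMap.coe_mk,
      AddHom.coe_mk, Sum.elim_inl, Sum.elim_inr, neg_mul, integral_neg] at h
    -- The factor `ε` in the reference measure cancels the `1/ε` in the direction, so annihilation
    -- of `V` becomes the marginal identity.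
    have e : ∀ z : X × X, ε * gibbs c ε z * ((φ.1 z.1 + φ.2 z.2) / ε * w (Sum.inr (Sum.inr z)))
        = gibbs c ε z * w (Sum.inr (Sum.inr z)) * (φ.1 z.1 + φ.2 z.2) := by
      intro z
      field_simp
    simp only [e] at h
    simp only [mul_comm (w _) (φ.1 _), mul_comm (w _) (φ.2 _)]
    linarith
  have hfin := isFiniteMeasure_withDensity_ofReal hGi.2
  refine ⟨⟨_, hfin⟩, ?_⟩
  rw [primalReg_withDensity hc hm hε μ₀ μ₁ ν ⟨_, hfin⟩ hm₀ (fun _ => hw0 _) hki₀ hm₁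
    (fun _ => hw0 _) hki₁ hm₂ (fun _ => hw0 _) hGi hki₂ rfl
    -- Potentials `(f, 0)` and `(0, f)` separate the two marginals.
    (map_withDensity_eq_withDensity measurable_fst (hdm.mul hm₂) hG0 hGi hm₀ (fun _ => hw0 _) hwi₀
      fun f => by simpa using hmarg (f, 0))
    (map_withDensity_eq_withDensity measurable_snd (hdm.mul hm₂) hG0 hGi hm₁ (fun _ => hw0 _) hwi₁
      fun f => by simpa using hmarg (0, f))]
  exact EReal.coe_le_coe_iff.2 (by linarith)

end StrongDuality

end UOT

end

/-! ### The duality theorem -/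

theorem mainTheorem8 {X : Type*} [MetricSpace X] [CompleteSpace X]
    [TopologicalSpace.SeparableSpace X] [MeasurableSpace X] [BorelSpace X]
    (c : X × X → EReal) (hc : LowerSemicontinuous c)
    (hc_bdd : ∃ m : ℝ, ∀ z, (m : EReal) ≤ c z)
    (μ₀ μ₁ : FiniteMeasure X) (ν : FiniteMeasure (X × X)) (ε : ℝ) (hε : 0 < ε) :
    UOT.uotReg c ε μ₀ μ₁ ν =
      ⨆ φ ∈ UOT.admissible X, UOT.dualReg c ε μ₀ μ₁ ν φ.1 φ.2 := by
  obtain ⟨m, hm⟩ := hc_bdd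
  -- Second countability makes the product σ-algebra on `X × X` Borel, so a lower semicontinuous `c`
  -- is measurable.
  have : SecondCountableTopology X := UniformSpace.secondCountable_of_separable X
  have hcm : Measurable c := hc.measurable
  have hdual : ∀ φ₀ φ₁ : X →ᵇ ℝ, UOT.dualReg c ε μ₀ μ₁ ν φ₀ φ₁
      = (UOT.dualValue c ε μ₀ μ₁ ν φ₀ φ₁ : EReal) :=
    UOT.dualReg_eq_dualValue hcm hm hε μ₀ μ₁ ν
  have hle : ∀ φ₀ φ₁ : X →ᵇ ℝ, (UOT.dualValue c ε μ₀ μ₁ ν φ₀ φ₁ : EReal) ≤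
      ⨆ φ ∈ UOT.admissible X, UOT.dualReg c ε μ₀ μ₁ ν φ.1 φ.2 := fun φ₀ φ₁ => by
    rw [← hdual]
    exact le_iSup₂_of_le (φ₀, φ₁) (UOT.mem_admissible _) le_rfl
  refine le_antisymm ?_ ?_
  -- Dual values are real, so the supremum is not `⊥`; if it is a real `A`, some `γ` has primal
  -- value at most `A`.
  · generalize (⨆ φ ∈ UOT.admissible X, UOT.dualReg c ε μ₀ μ₁ ν φ.1 φ.2) = S at hle
    induction S with
    | bot => exact absurd (hle 0 0) (EReal.bot_lt_coe _).not_ge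
    | top => exact le_top
    | coe A =>
      obtain ⟨γ, hγ⟩ := UOT.exists_primalReg_le hcm hm hε μ₀ μ₁ ν
        fun φ₀ φ₁ => EReal.coe_le_coe_iff.1 (hle φ₀ φ₁)
      exact iInf_le_of_le γ hγ
  · refine iSup₂_le fun φ _ => le_iInf fun γ => ?_
    rw [hdual]
    exact UOT.dualValue_le_primalReg hcm hm hε μ₀ μ₁ ν γ φ.1 φ.2
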